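/- For $\kappa>0$ and $D\ge 2$ let $\mathbb{L}_\kappa^D=\{z\in\mathbb{R}^{D+1} : z\circ z=-1/\kappa,\ z_1>0\}$, where $x\circ y=-x_1y_1+\sum_{i=2}^{D+1}x_iy_i$, be the Lorentz model of the $D$-dimensional hyperbolic space of curvature $-\kappa$, with geodesic distance $d(x,y)=\frac{1}{\sqrt{\kappa}}\operatorname{arccosh}(-\kappa\,(x\circ y))$. Let $T_{m,h}$ be the complete $m$-ary tree of depth $h$ (every node of depth less than $h$ has exactly $m$ children), with its graph distance $d_T$. A map $f$ from the nodes of $T_{m,h}$ to $\mathbb{L}_\kappa^D$ is an embedding with distortion at most $L$ if there is a scale $r>0$ such that $$r\,d_T(u,v)\le d(f(u),f(v))\le L\,r\,d_T(u,v)\qquad\text{for all nodes }u,v.$$ **Proposition.** For every $L\ge 1$ there is a constant $c>0$, depending only on $L$, such that for every $D\ge 2$ there is a depth $h_0$, depending only on $L$ and $D$, with the following property. For all $m\ge 1$, $\kappa>0$ and $h\ge h_0$, every embedding $f$ of $T_{m,h}$ into $\mathbb{L}_\kappa^D$ with distortion at most $L$ satisfies $$d(f(u),f(v))\ \ge\ c\,\frac{\ln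 m}{(D-1)\sqrt{\kappa}}$$ for every node $u$ and every child $v$ of $u$. That is, at bounded distortion and sufficiently large depth, the minimum parent–child distance is $s=\Omega\!\left(\frac{\ln m}{(D-1)\sqrt{\kappa}}\right)$. -/

import Mathlib

/-- The Lorentz inner product `x ∘ y = -x₁ y₁ + x̄ᵀ ȳ` on `ℝ^{D+1}`; coordinate `0` is the time
component and the coordinates `i.succ` are the space components. -/
def lorentzInner {D : ℕ} (x y : Fin (D + 1) → ℝ) : ℝ :=
  -(x 0 * y 0) + ∑ i : Fin D, x i.succ * y i.succ

/-- The hyperbolic space `𝕃_κ^D` of curvature `-κ`: the upper sheet of the hyperboloid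
`z ∘ z = -1/κ` in `ℝ^{D+1}`. -/
def LorentzModel (κ : ℝ) (D : ℕ) : Type :=
  {z : Fin (D + 1) → ℝ // lorentzInner z z = -1 / κ ∧ 0 < z 0}

/-- The geodesic distance of `𝕃_κ^D`. -/
noncomputable def LorentzModel.geodesicDist {κ : ℝ} {D : ℕ} (x y : LorentzModel κ D) : ℝ :=
  1 / √κ * Real.arcosh (-κ * lorentzInner x.1 y.1)

/-- The nodes of the complete `m`-ary tree of depth `h`: words of length at most `h` over an
alphabet with `m` letters. The empty word is the root, and the length of a word is its depth. -/
def TreeNode (m h : ℕ) : Type :=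
  {w : List (Fin m) // w.length ≤ h}

/-- `u.IsParentOf v`: the node `v` is one of the children `a :: u` of `u`. -/
def TreeNode.IsParentOf {m h : ℕ} (u v : TreeNode m h) : Prop :=
  ∃ a : Fin m, v.1 = a :: u.1

/-- The complete `m`-ary tree of depth `h`, as a graph: the edges join the nodes to their
children. -/
def maryTree (m h : ℕ) : SimpleGraph (TreeNode m h) :=
  SimpleGraph.fromRel TreeNode.IsParentOf

/-- The map `f` embeds the vertices of the graph `G`, with the graph distance, into `𝕃_κ^D` with
distortion at most `L`: up to one common scale `r > 0`, all pairwise graph distances are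
preserved within a factor `L`. -/
def EmbedsWithDistortion {V : Type} (G : SimpleGraph V) {κ : ℝ} {D : ℕ}
    (f : V → LorentzModel κ D) (L : ℝ) : Prop :=
  ∃ r : ℝ, 0 < r ∧ ∀ u v : V,
    r * (G.dist u v : ℝ) ≤ (f u).geodesicDist (f v) ∧
      (f u).geodesicDist (f v) ≤ L * (r * (G.dist u v : ℝ))

/-! The proof counts leaves. At scale `r`, the `m ^ h` leaves are `r`-separated and lie within `L *
r * h` of the image of the root. A Lorentz boost taking that image to the apex, followed by dropping
the time coordinate, does not shrink rescaled distances and sends radius `R` to `sinh R`, so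
Euclidean volume packing bounds the number of leaves (`LorentzModel.card_le_of_separated`). With `a
= √κ * r`, taking logarithms gives `h log m ≤ D (log (1 + 2Lh) + L h a)`. At large depth the
logarithm on the right absorbs at most half of the left side, so `a` is at least of order `log m /
D`. Every edge has length at least `r`. -/

open Metric MeasureTheory in
/-- A `δ`-separated finite subset of a ball of radius `ρ` in a `d`-dimensional normed space has at
most `(1 + 2 ρ / δ) ^ d` elements. -/
theorem card_le_of_separated_of_norm_le {E : Type*} [NormedAddCommGroup E] [NormedSpace ℝ E]
    [FiniteDimensional ℝ E] (s : Finset E) {δ ρ : ℝ} (hδ : 0 < δ) (hρ : 0 ≤ ρ)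
    (hs : ∀ x ∈ s, ‖x‖ ≤ ρ) (h : ∀ x ∈ s, ∀ y ∈ s, x ≠ y → δ ≤ ‖x - y‖) :
    (s.card : ℝ) ≤ (1 + 2 * ρ / δ) ^ Module.finrank ℝ E := by
  borelize E
  let μ : Measure E := Measure.addHaar
  have hδ2 : 0 < δ / 2 := by positivity
  have hR : 0 < ρ + δ / 2 := by positivity
  have hdisj : Set.Pairwise (s : Set E) (Function.onFun Disjoint fun c => ball c (δ / 2)) := by
    intro x hx y hy hxy
    apply ball_disjoint_ball
    rw [dist_eq_norm, add_halves]
    exact h x hx y hy hxy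
  have hsub : (⋃ c ∈ s, ball c (δ / 2)) ⊆ ball (0 : E) (ρ + δ / 2) := by
    refine Set.iUnion₂_subset fun x hx => ball_subset_ball' ?_
    rw [dist_zero_right]
    linarith [hs x hx]
  have hvol : (s.card : ENNReal) * ENNReal.ofReal ((δ / 2) ^ Module.finrank ℝ E) * μ (ball 0 1) ≤
      ENNReal.ofReal ((ρ + δ / 2) ^ Module.finrank ℝ E) * μ (ball 0 1) := by
    rw [← μ.addHaar_ball_of_pos 0 hR]
    refine le_trans (le_of_eq ?_) (measure_mono hsub)
    rw [measure_biUnion_finset hdisj fun c _ => measurableSet_ball]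
    simp only [μ.addHaar_ball_of_pos _ hδ2, Finset.sum_const, nsmul_eq_mul, mul_assoc]
  have hcard := (ENNReal.mul_le_mul_iff_left (measure_ball_pos _ _ zero_lt_one).ne'
    measure_ball_lt_top.ne).1 hvol
  have hreal : (s.card : ℝ) * (δ / 2) ^ Module.finrank ℝ E ≤
      (ρ + δ / 2) ^ Module.finrank ℝ E := by
    have := ENNReal.toReal_le_of_le_ofReal (pow_nonneg hR.le _) hcard
    rwa [ENNReal.toReal_mul, ENNReal.toReal_natCast, ENNReal.toReal_ofReal (by positivity)] at this
  rw [show 1 + 2 * ρ / δ = (ρ + δ / 2) / (δ / 2) by field_simp; ring, div_pow]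
  exact (le_div_iff₀ (by positivity)).2 hreal

section Lorentz

variable {D : ℕ}

theorem lorentzInner_smul (a : ℝ) (x y : Fin (D + 1) → ℝ) :
    lorentzInner (a • x) (a • y) = a ^ 2 * lorentzInner x y := by
  simp only [lorentzInner, Pi.smul_apply, smul_eq_mul, mul_add, Finset.mul_sum]
  congr 1
  · ring
  · exact Finset.sum_congr rfl fun i _ => by ring

theorem lorentzInner_sub_sub_self (x y : Fin (D + 1) → ℝ) :
    lorentzInner (x - y) (x - y) =
      lorentzInner x x + lorentzInner y y - 2 * lorentzInner x y := by
  have h : ∑ i : Fin D, (x i.succ - y i.succ) * (x i.succ - y i.succ) =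
      ∑ i : Fin D, x i.succ * x i.succ + ∑ i : Fin D, y i.succ * y i.succ -
        2 * ∑ i : Fin D, x i.succ * y i.succ := by
    rw [Finset.mul_sum, ← Finset.sum_add_distrib, ← Finset.sum_sub_distrib]
    exact Finset.sum_congr rfl fun i _ => by ring
  simp only [lorentzInner, Pi.sub_apply, h]
  ring

/-- The reverse Cauchy–Schwarz inequality on the upper sheet of the unit hyperboloid. -/
theorem one_le_neg_lorentzInner {x y : Fin (D + 1) → ℝ} (hx : lorentzInner x x = -1)
    (hx0 : 0 < x 0) (hy : lorentzInner y y = -1) (hy0 : 0 < y 0) : 1 ≤ -lorentzInner x y := by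
  have hcs := Finset.sum_mul_sq_le_sq_mul_sq Finset.univ
    (fun i : Fin D => x i.succ) (fun i => y i.succ)
  have hA : 0 ≤ ∑ i : Fin D, x i.succ ^ 2 := Finset.sum_nonneg fun i _ => sq_nonneg _
  have hB : 0 ≤ ∑ i : Fin D, y i.succ ^ 2 := Finset.sum_nonneg fun i _ => sq_nonneg _
  simp only [lorentzInner, ← sq] at hx hy ⊢
  set A := ∑ i : Fin D, x i.succ ^ 2
  set B := ∑ i : Fin D, y i.succ ^ 2
  set a := ∑ i : Fin D, x i.succ * y i.succ
  have h2a : 2 * a ≤ A + B := by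
    refine le_of_abs_le (abs_le_of_sq_le_sq ?_ (by positivity))
    nlinarith [sq_nonneg (A - B)]
  -- Squared, this is `(1 + a)² ≤ (1 + A)(1 + B)`, the sum of `a² ≤ A B` and `2a ≤ A + B`.
  have h1a : 1 + a ≤ x 0 * y 0 := by
    refine le_of_abs_le (abs_le_of_sq_le_sq ?_ (by positivity))
    rw [mul_pow, show x 0 ^ 2 = 1 + A by linarith, show y 0 ^ 2 = 1 + B by linarith]
    nlinarith
  linarith

/-- The space component of the Lorentz boost that moves the point `p` of the unit hyperboloid to
the apex. -/
noncomputable def boostSpace (p z : Fin (D + 1) → ℝ) : EuclideanSpace ℝ (Fin D) :=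
  WithLp.toLp 2 fun i =>
    z i.succ + ((∑ j : Fin D, p j.succ * z j.succ) / (1 + p 0) - z 0) * p i.succ

theorem boostSpace_sub (p x y : Fin (D + 1) → ℝ) :
    boostSpace p (x - y) = boostSpace p x - boostSpace p y := by
  ext i
  simp only [boostSpace, Pi.sub_apply, PiLp.sub_apply, mul_sub, Finset.sum_sub_distrib]
  ring

/-- The boost preserves the Lorentz form, and the time component of the image is `-lorentzInner p
z`. Allowing `z` off the hyperboloid makes this applicable to differences. -/
theorem norm_sq_boostSpace {p : Fin (D + 1) → ℝ} (hp : lorentzInner p p = -1) (hp0 : 0 < p 0)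
    (z : Fin (D + 1) → ℝ) :
    ‖boostSpace p z‖ ^ 2 = lorentzInner z z + lorentzInner p z ^ 2 := by
  have hexp (c : ℝ) : ∑ i : Fin D, (z i.succ + c * p i.succ) ^ 2 =
      ∑ i : Fin D, z i.succ * z i.succ + 2 * c * ∑ i : Fin D, p i.succ * z i.succ +
        c ^ 2 * ∑ i : Fin D, p i.succ * p i.succ := by
    rw [Finset.mul_sum, Finset.mul_sum, ← Finset.sum_add_distrib, ← Finset.sum_add_distrib]
    exact Finset.sum_congr rfl fun i _ => by ring
  have hpp : ∑ i : Fin D, p i.succ * p i.succ = p 0 * p 0 - 1 := by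
    simp only [lorentzInner] at hp
    linarith
  rw [EuclideanSpace.norm_sq_eq]
  simp only [boostSpace, Real.norm_eq_abs, sq_abs, hexp, hpp, lorentzInner]
  have : 1 + p 0 ≠ 0 := by positivity
  field_simp
  ring

/-- With `δ` the distance, the Lorentz square of `x - y` is `2 (cosh δ - 1) = 4 sinh² (δ / 2) ≥ δ²`,
and dropping the time component only increases it. -/
theorem le_norm_boostSpace_sub {p x y : Fin (D + 1) → ℝ} (hp : lorentzInner p p = -1)
    (hp0 : 0 < p 0) (hx : lorentzInner x x = -1) (hx0 : 0 < x 0) (hy : lorentzInner y y = -1)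
    (hy0 : 0 < y 0) :
    Real.arcosh (-lorentzInner x y) ≤ ‖boostSpace p x - boostSpace p y‖ := by
  have h1 := one_le_neg_lorentzInner hx hx0 hy hy0
  have hcosh := Real.cosh_arcosh h1
  have h0 := Real.arcosh_nonneg h1
  set δ := Real.arcosh (-lorentzInner x y)
  have hsinh : δ / 2 ≤ Real.sinh (δ / 2) := Real.self_le_sinh_iff.2 (by positivity)
  have hdouble : Real.cosh δ = 1 + 2 * Real.sinh (δ / 2) ^ 2 := by
    have h := Real.cosh_two_mul (δ / 2)
    rw [mul_div_cancel₀ _ two_ne_zero, Real.cosh_sq] at h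
    linarith
  refine le_of_abs_le (abs_le_of_sq_le_sq ?_ (norm_nonneg _))
  rw [← boostSpace_sub, norm_sq_boostSpace hp hp0, lorentzInner_sub_sub_self, hx, hy]
  nlinarith [sq_nonneg (lorentzInner p (x - y))]

theorem norm_boostSpace_le {p x : Fin (D + 1) → ℝ} (hp : lorentzInner p p = -1)
    (hp0 : 0 < p 0) (hx : lorentzInner x x = -1) (hx0 : 0 < x 0) {R : ℝ}
    (hR : Real.arcosh (-lorentzInner p x) ≤ R) : ‖boostSpace p x‖ ≤ Real.sinh R := by
  have h1 := one_le_neg_lorentzInner hp hp0 hx hx0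
  refine le_trans (le_of_eq ?_) (Real.sinh_le_sinh.2 hR)
  rw [Real.sinh_arcosh h1, ← Real.sqrt_sq (norm_nonneg _), norm_sq_boostSpace hp hp0, hx, neg_sq]
  congr 1
  ring

end Lorentz

namespace LorentzModel

variable {κ : ℝ} {D : ℕ}

/-- The point of the unit hyperboloid that corresponds to a point of `𝕃_κ^D`. -/
noncomputable def unitPoint (x : LorentzModel κ D) : Fin (D + 1) → ℝ := √κ • x.1

theorem lorentzInner_unitPoint (hκ : 0 < κ) (x y : LorentzModel κ D) :
    lorentzInner x.unitPoint y.unitPoint = κ * lorentzInner x.1 y.1 := by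
  rw [unitPoint, unitPoint, lorentzInner_smul, Real.sq_sqrt hκ.le]

theorem lorentzInner_unitPoint_self (hκ : 0 < κ) (x : LorentzModel κ D) :
    lorentzInner x.unitPoint x.unitPoint = -1 := by
  rw [lorentzInner_unitPoint hκ, x.2.1]
  field_simp

theorem unitPoint_zero_pos (hκ : 0 < κ) (x : LorentzModel κ D) : 0 < x.unitPoint 0 :=
  mul_pos (Real.sqrt_pos.2 hκ) x.2.2

theorem arcosh_unitPoint (hκ : 0 < κ) (x y : LorentzModel κ D) :
    Real.arcosh (-lorentzInner x.unitPoint y.unitPoint) = √κ * x.geodesicDist y := by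
  have : √κ ≠ 0 := (Real.sqrt_pos.2 hκ).ne'
  rw [lorentzInner_unitPoint hκ, geodesicDist, neg_mul]
  field_simp

/-- The number of points of a `δ`-separated family in a ball of radius `R` of `𝕃_κ^D`. -/
theorem card_le_of_separated (hκ : 0 < κ) {ι : Type*} [Fintype ι] (p : LorentzModel κ D)
    (x : ι → LorentzModel κ D) {δ R : ℝ} (hδ : 0 < δ) (hR : 0 ≤ R)
    (hball : ∀ i, √κ * p.geodesicDist (x i) ≤ R)
    (hsep : ∀ i j, i ≠ j → δ ≤ √κ * (x i).geodesicDist (x j)) :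
    (Fintype.card ι : ℝ) ≤ (1 + 2 * Real.sinh R / δ) ^ D := by
  classical
  let g : ι → EuclideanSpace ℝ (Fin D) := fun i => boostSpace p.unitPoint (x i).unitPoint
  have hg (i j) (hij : i ≠ j) : δ ≤ ‖g i - g j‖ := by
    refine (hsep i j hij).trans ?_
    rw [← arcosh_unitPoint hκ]
    exact le_norm_boostSpace_sub (lorentzInner_unitPoint_self hκ _) (unitPoint_zero_pos hκ _)
      (lorentzInner_unitPoint_self hκ _) (unitPoint_zero_pos hκ _)
      (lorentzInner_unitPoint_self hκ _) (unitPoint_zero_pos hκ _)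
  have hinj : Function.Injective g := by
    intro i j hij
    by_contra hne
    have := hg i j hne
    rw [hij, sub_self, norm_zero] at this
    linarith
  have h := card_le_of_separated_of_norm_le (Finset.univ.image g) hδ (Real.sinh_nonneg_iff.2 hR)
    (by
      simp only [Finset.mem_image, Finset.mem_univ, true_and, forall_exists_index,
        forall_apply_eq_imp_iff]
      intro i
      refine norm_boostSpace_le (lorentzInner_unitPoint_self hκ _) (unitPoint_zero_pos hκ _)
        (lorentzInner_unitPoint_self hκ _) (unitPoint_zero_pos hκ _) ?_
      rw [arcosh_unitPoint hκ]
      exact hball i)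
    (by
      simp only [Finset.mem_image, Finset.mem_univ, true_and, forall_exists_index,
        forall_apply_eq_imp_iff]
      intro i j hij
      exact hg i j fun h => hij (by rw [h]))
  rwa [Finset.card_image_of_injective _ hinj, Finset.card_univ, finrank_euclideanSpace_fin] at h

end LorentzModel

section Tree

variable {m h : ℕ}

/-- The root of the tree. -/
def TreeNode.root (m h : ℕ) : TreeNode m h := ⟨[], Nat.zero_le h⟩

theorem TreeNode.IsParentOf.adj {u v : TreeNode m h} (huv : u.IsParentOf v) :
    (maryTree m h).Adj u v := by
  rw [maryTree, SimpleGraph.fromRel_adj]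
  refine ⟨?_, Or.inl huv⟩
  rintro rfl
  obtain ⟨a, ha⟩ := huv
  simpa using congrArg List.length ha

theorem exists_walk_root_length_eq :
    ∀ (w : List (Fin m)) (hw : w.length ≤ h),
      ∃ q : (maryTree m h).Walk (TreeNode.root m h) ⟨w, hw⟩, q.length = w.length
  | [], _ => ⟨SimpleGraph.Walk.nil, rfl⟩
  | a :: w, hw => by
    have hw' : w.length ≤ h := (Nat.le_succ _).trans hw
    obtain ⟨q, hq⟩ := exists_walk_root_length_eq w hw'
    have hadj : (maryTree m h).Adj ⟨w, hw'⟩ ⟨a :: w, hw⟩ := TreeNode.IsParentOf.adj ⟨a, rfl⟩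
    exact ⟨q.concat hadj, (SimpleGraph.Walk.length_concat q hadj).trans (congrArg (· + 1) hq)⟩

theorem maryTree_dist_root_le (v : TreeNode m h) :
    (maryTree m h).dist (TreeNode.root m h) v ≤ h := by
  obtain ⟨q, hq⟩ := exists_walk_root_length_eq v.1 v.2
  exact ((SimpleGraph.dist_le q).trans_eq hq).trans v.2

theorem one_le_maryTree_dist {u v : TreeNode m h} (huv : u ≠ v) :
    1 ≤ (maryTree m h).dist u v := by
  obtain ⟨p, -⟩ := exists_walk_root_length_eq u.1 u.2
  obtain ⟨q, -⟩ := exists_walk_root_length_eq v.1 v.2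
  exact SimpleGraph.Reachable.pos_dist_of_ne ⟨p.reverse.append q⟩ huv

/-- The leaves of the tree, indexed by their letters. -/
def TreeNode.leaf (w : Fin h → Fin m) : TreeNode m h := ⟨List.ofFn w, by simp⟩

theorem TreeNode.leaf_injective : Function.Injective (TreeNode.leaf : (Fin h → Fin m) → _) :=
  fun _ _ hvw => List.ofFn_injective (congrArg Subtype.val hvw)

end Tree

/-- The factor `x` cancels the separation `a` in the packing bound, which leaves a prefactor
independent of the scale. -/
theorem sinh_le_mul_exp (x : ℝ) : Real.sinh x ≤ x * Real.exp x := by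
  have h1 := Real.add_one_le_exp (-2 * x)
  have h2 : Real.exp (-x) = Real.exp x * Real.exp (-2 * x) := by
    rw [← Real.exp_add]
    ring_nf
  rw [Real.sinh_eq, h2]
  nlinarith [Real.exp_pos x]

open Filter in
theorem exists_forall_mul_log_le (D L : ℝ) (hD : 0 < D) (hL : 1 ≤ L) :
    ∃ h₀ : ℕ, 1 ≤ h₀ ∧ ∀ h : ℕ, h₀ ≤ h →
      D * Real.log (1 + 2 * L * h) ≤ Real.log 2 / 2 * h := by
  have hlim : Tendsto (fun h : ℕ => 1 + 2 * L * (h : ℝ)) atTop atTop :=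
    tendsto_atTop_add_const_left _ _
      (tendsto_natCast_atTop_atTop.const_mul_atTop (by positivity))
  -- Chosen so that `1 + 2Lh ≤ 4Lh` yields exactly `log 2 / 2 * h`.
  have hε : 0 < Real.log 2 / (8 * L * D) := by
    have := Real.log_pos one_lt_two
    positivity
  obtain ⟨N, hN⟩ := eventually_atTop.1
    (hlim.eventually (Real.isLittleO_log_id_atTop.bound hε))
  refine ⟨N + 1, by omega, fun h hh => ?_⟩
  have hb := hN h (by omega)
  have h1 : (1 : ℝ) ≤ h := by exact_mod_cast (by omega : 1 ≤ h)
  rw [id, Real.norm_eq_abs, Real.norm_eq_abs, abs_of_nonneg (by positivity : 0 ≤ 1 + 2 * L * (h : ℝ))]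
    at hb
  calc D * Real.log (1 + 2 * L * h)
      ≤ D * (Real.log 2 / (8 * L * D) * (4 * L * h)) := by
        gcongr
        refine (le_of_abs_le hb).trans ?_
        gcongr
        nlinarith
    _ = Real.log 2 / 2 * h := by
        field_simp
        ring

/-- A lower bound for the scale of an embedding of the complete `m`-ary tree of depth `h`. -/
theorem mul_log_le_of_embedding {m h D : ℕ} {κ L r : ℝ} (hm : 1 ≤ m) (hκ : 0 < κ) (hL : 0 ≤ L)
    (hr : 0 < r) (f : TreeNode m h → LorentzModel κ D)
    (hf : ∀ u v, r * ((maryTree m h).dist u v : ℝ) ≤ (f u).geodesicDist (f v) ∧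
      (f u).geodesicDist (f v) ≤ L * (r * ((maryTree m h).dist u v : ℝ))) :
    h * Real.log m ≤ D * (Real.log (1 + 2 * L * h) + L * h * (√κ * r)) := by
  have hs : 0 < √κ := Real.sqrt_pos.2 hκ
  set a := √κ * r with ha
  have ha0 : 0 < a := mul_pos hs hr
  have hcard := LorentzModel.card_le_of_separated hκ (f (TreeNode.root m h))
    (fun w : Fin h → Fin m => f (TreeNode.leaf w)) (δ := a) (R := L * h * a) ha0 (by positivity)
    (by
      intro w
      have hd : ((maryTree m h).dist (TreeNode.root m h) (TreeNode.leaf w) : ℝ) ≤ h := by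
        exact_mod_cast maryTree_dist_root_le _
      calc √κ * (f (TreeNode.root m h)).geodesicDist (f (TreeNode.leaf w))
          ≤ √κ * (L * (r * h)) := by
            gcongr
            refine (hf _ _).2.trans ?_
            gcongr
        _ = L * h * a := by rw [ha]; ring)
    (by
      intro v w hvw
      have hd : (1 : ℝ) ≤ (maryTree m h).dist (TreeNode.leaf v) (TreeNode.leaf w) := by
        exact_mod_cast one_le_maryTree_dist (TreeNode.leaf_injective.ne hvw)
      rw [ha]
      gcongr
      refine le_trans ?_ (hf _ _).1
      nlinarith)
  rw [Fintype.card_fun, Fintype.card_fin, Fintype.card_fin, Nat.cast_pow] at hcard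
  have hbase : 1 + 2 * Real.sinh (L * h * a) / a ≤ (1 + 2 * L * h) * Real.exp (L * h * a) := by
    have h1 : 2 * Real.sinh (L * h * a) / a ≤ 2 * L * h * Real.exp (L * h * a) := by
      rw [div_le_iff₀ ha0]
      linarith [sinh_le_mul_exp (L * h * a)]
    have h2 : 1 ≤ Real.exp (L * h * a) := Real.one_le_exp (by positivity)
    linarith
  have hsinh : 0 ≤ Real.sinh (L * h * a) := Real.sinh_nonneg_iff.2 (by positivity)
  have hm0 : (0 : ℝ) < m := by exact_mod_cast hm
  have hfin : (m : ℝ) ^ h ≤ ((1 + 2 * L * h) * Real.exp (L * h * a)) ^ D :=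
    hcard.trans (pow_le_pow_left₀ (by positivity) hbase D)
  have hlog := Real.log_le_log (by positivity) hfin
  rwa [Real.log_pow, Real.log_pow, Real.log_mul (by positivity) (Real.exp_pos _).ne',
    Real.log_exp] at hlog

theorem mainTheorem5 (L : ℝ) (hL : 1 ≤ L) :
    ∃ c : ℝ, 0 < c ∧ ∀ D : ℕ, 2 ≤ D → ∃ h₀ : ℕ,
      ∀ (m h : ℕ) (κ : ℝ), 1 ≤ m → h₀ ≤ h → 0 < κ →
        ∀ f : TreeNode m h → LorentzModel κ D, EmbedsWithDistortion (maryTree m h) f L →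
          ∀ u v : TreeNode m h, u.IsParentOf v →
            c * (Real.log (m : ℝ) / (((D : ℝ) - 1) * √κ)) ≤ (f u).geodesicDist (f v) := by
  refine ⟨1 / (4 * L), by positivity, fun D hD => ?_⟩
  have hD2 : (2 : ℝ) ≤ D := by exact_mod_cast hD
  obtain ⟨h₀, hh₀, hlog⟩ := exists_forall_mul_log_le D L (by linarith) hL
  refine ⟨h₀, fun m h κ hm hh hκ f ⟨r, hr, hf⟩ u v huv => ?_⟩
  have hs : 0 < √κ := Real.sqrt_pos.2 hκ
  have hD1 : 0 < (D : ℝ) - 1 := by linarith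
  have hL0 : 0 < L := by linarith
  have hrd : r ≤ (f u).geodesicDist (f v) := by
    have hd : (1 : ℝ) ≤ (maryTree m h).dist u v := by
      exact_mod_cast one_le_maryTree_dist huv.adj.ne
    refine le_trans ?_ (hf u v).1
    nlinarith
  refine le_trans ?_ hrd
  -- For `m = 1` the bound is trivial; otherwise `log m ≥ log 2`, so the depth threshold need not
  -- depend on `m`.
  rcases hm.eq_or_lt with rfl | hm2
  · simpa using hr.le
  have hlog2 : Real.log 2 ≤ Real.log m := Real.log_le_log two_pos (by exact_mod_cast hm2)
  have h1 : (0 : ℝ) < h := by exact_mod_cast (by omega : 0 < h)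
  have hmain := mul_log_le_of_embedding hm hκ hL0.le hr f hf
  have hrest := hlog h hh
  have hle : h * Real.log m ≤ h * (4 * L * (D - 1) * (√κ * r)) := by
    have e1 : Real.log 2 / 2 * h ≤ Real.log m / 2 * h := by gcongr
    -- `D ≤ 2 (D - 1)` costs one factor 2 of the constant `1 / (4 * L)`; the absorbed half of `h log
    -- m` costs the other.
    have e2 : (D : ℝ) * (L * h * (√κ * r)) ≤ 2 * (D - 1) * (L * h * (√κ * r)) := by
      gcongr
      linarith
    linarith
  have hfinal := le_of_mul_le_mul_left hle h1
  rw [div_mul_div_comm, div_le_iff₀ (by positivity)]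
  linarith
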